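/- Let $k$ be an algebraically closed field, $n\ge d\ge 1$ and $D\ge 2$ integers, and let $\mathcal A=\{\mathbf a_0,\dots,\mathbf a_n\}\subset\mathbb N^d$ be a set of $n+1$ distinct vectors $\mathbf a_i=(a_{i1},\dots,a_{id})$ such that $\mathbf a_0=\mathbf 0$, $D\epsilon'_1,\dots,D\epsilon'_d\in\mathcal A$ (with $\epsilon'_1,\dots,\epsilon'_d$ the canonical basis of $\mathbb N^d$), and $|\mathbf a_i|:=a_{i1}+\dots+a_{id}\le D$ for all $i$. Put $a_{i0}:=D-|\mathbf a_i|$, let $\underline{\mathcal A}=\{\underline{\mathbf a}_0,\dots,\underline{\mathbf a}_n\}\subset\mathbb N^{d+1}$ with $\underline{\mathbf a}_i=(a_{i0},a_{i1},\dots,a_{id})$ be the homogenization of $\mathcal A$, let $\epsilon_0,\dots,\epsilon_d$ be the canonical basis of $\mathbb N^{d+1}$, and let $\mathcal X_{\underline{\mathcal A}}=V(I_{\underline{\mathcal A}})\subset\mathbb P^n_k$, where $I_{\underline{\mathcal A}}$ is the kernel of the $k$-algebra homomorphism $k[x_0,\dots,x_n]\to k[t_0,\dots,t_d]$, $x_i\mapsto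 t_0^{a_{i0}}t_1^{a_{i1}}\cdots t_d^{a_{id}}$. For $s\in\mathbb N$ let $s\mathcal A$ be the set of all sums of $s$ elements of $\mathcal A$ (repetitions allowed, $0\mathcal A=\{\mathbf 0\}$), and for $e\ge 1$ put $\mathbb N^d_e=\{\mathbf y\in\mathbb N^d: e \text{ divides } |\mathbf y|\}$ and $\Delta_{s,e}=\{\mathbf y\in\mathbb N^d_e: |\mathbf y|\le sD\}$. Consider the following conditions, the last three for a positive integer $e$: (a) $\mathcal X_{\underline{\mathcal A}}$ has exactly one singular point, and it is $(1:0:\dots:0)$. (b$_e$) $e\le D$ is a divisor of $D$ that divides $a_{i0}$ for all $i\in\{0,\dots,n\}$; $\{(D-1)\epsilon_i+\epsilon_j: 1\le i,j\le d\}\cup\{e\epsilon_0+(D-e)\epsilon_j: 1\le j\le d\}\subset\underline{\mathcal A}$; and if $e=1$, then $(D-1)\epsilon_0+\epsilon_j\notin\underline{\mathcal A}$ for some $j\in\{1,\dots,d\}$. (c$_e$) $e\le D$ is a divisor of $D$ that divides $|\mathbf a_i|$ for all $i\in\{0,\dots,n\}$; $\{\mathbf 0\}\cup\{(D-1)\epsilon'_i+\epsilon'_j: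 1\le i,j\le d\}\cup\{(D-e)\epsilon'_i: 1\le i\le d\}\subset\mathcal A$; and if $e=1$, then $\epsilon'_j\notin\mathcal A$ for some $j\in\{1,\dots,d\}$. (d$_e$) There exist a finite set $\mathcal H\subset\mathbb N^d_e$, with $\mathcal H\ne\emptyset$ if $e=1$, and a number $s_0\in\mathbb N$ such that $s\mathcal A=\Delta_{s,e}\setminus\mathcal H$ for all $s\ge s_0$. Then, for every $e$, the conditions (b$_e$), (c$_e$) and (d$_e$) are equivalent. If moreover the greatest common divisor of all the coordinates $a_{ij}$ ($0\le i\le n$, $1\le j\le d$) is $1$, then the following are equivalent: (a); (b$_e$) holds for some $e$; (c$_e$) holds for some $e$; (d$_e$) holds for some $e$. -/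

import Mathlib

open MvPolynomial

noncomputable section

namespace OneSing

/-! ### Projective algebraic sets and their singular points -/

/-- The projective zero locus `V(I) ⊆ ℙⁿ(k)`: a point of `ℙⁿ(k)` is a line in `k^(n+1)`, and it
belongs to `V(I)` when every element of `I` vanishes on that line (for a homogeneous ideal it
suffices to test one nonzero vector of the line). -/
def projZeroLocus {k : Type*} [Field k] {n : ℕ} (I : Ideal (MvPolynomial (Fin (n + 1)) k)) :
    Set (Projectivization k (Fin (n + 1) → k)) :=
  {P | (P.submodule : Set (Fin (n + 1) → k)) ⊆ zeroLocus k I}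

/-- The affine cone over a subset of projective space: the union of the lines in it. -/
def affineCone {k : Type*} [Field k] {n : ℕ} (X : Set (Projectivization k (Fin (n + 1) → k))) :
    Set (Fin (n + 1) → k) :=
  {v | ∃ P ∈ X, v ∈ P.submodule}

/-- The vanishing ideal `I(X)` of `X ⊆ ℙⁿ(k)`. -/
def projVanishingIdeal {k : Type*} [Field k] {n : ℕ}
    (X : Set (Projectivization k (Fin (n + 1) → k))) : Ideal (MvPolynomial (Fin (n + 1)) k) :=
  vanishingIdeal k (affineCone X)

/-- The row space of the Jacobian matrix of the ideal `I` at the vector `v`: the span of the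
gradients at `v` of the elements of `I`. -/
def jacobianSpan {k : Type*} [Field k] {n : ℕ} (I : Ideal (MvPolynomial (Fin (n + 1)) k))
    (v : Fin (n + 1) → k) : Submodule k (Fin (n + 1) → k) :=
  Submodule.span k {w | ∃ f ∈ I, w = fun i => eval v (pderiv i f)}

/-- `P` is a singular point of the projective variety `X ⊆ ℙⁿ(k)`: it lies on `X` and the rank at
`P` of the Jacobian matrix of `I(X)` is smaller than the codimension `n - dim X`. Here `dim X + 1` is
the Krull dimension of the homogeneous coordinate ring, and `rank < n - dim X` is written as
`rank + (dim X + 1) < n + 1`. -/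
def IsSingularPoint {k : Type*} [Field k] {n : ℕ} (X : Set (Projectivization k (Fin (n + 1) → k)))
    (P : Projectivization k (Fin (n + 1) → k)) : Prop :=
  P ∈ X ∧
    ((Module.finrank k (jacobianSpan (projVanishingIdeal X) P.rep) : ℕ) : WithBot ℕ∞) +
      ringKrullDim (MvPolynomial (Fin (n + 1)) k ⧸ projVanishingIdeal X) <
        ((n + 1 : ℕ) : WithBot ℕ∞)

/-- The point `(1 : 0 : ⋯ : 0)` of `ℙⁿ(k)`. -/
def firstPoint (k : Type*) [Field k] (n : ℕ) : Projectivization k (Fin (n + 1) → k) :=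
  Projectivization.mk k (Pi.single 0 1) (by simp)

/-! ### Toric ideals and projective toric varieties -/

/-- The toric ideal of `b₀, …, bₙ ∈ ℕ^m`: the kernel of `k[x₀, …, xₙ] → k[t₁, …, t_m]`,
`xᵢ ↦ t^(bᵢ)`. -/
def toricIdeal (k : Type*) [Field k] {n m : ℕ} (b : Fin (n + 1) → Fin m → ℕ) :
    Ideal (MvPolynomial (Fin (n + 1)) k) :=
  RingHom.ker
    (aeval (fun i => ∏ j, X j ^ b i j) : MvPolynomial (Fin (n + 1)) k →ₐ[k] MvPolynomial (Fin m) k)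

/-- The projective toric variety `V(I_b) ⊆ ℙⁿ(k)`. -/
def toricVariety (k : Type*) [Field k] {n m : ℕ} (b : Fin (n + 1) → Fin m → ℕ) :
    Set (Projectivization k (Fin (n + 1) → k)) :=
  projZeroLocus (toricIdeal k b)

/-! ### Point sets in `ℕ^d` -/

/-- The coordinate sum `|y|`. -/
def size {d : ℕ} (y : Fin d → ℕ) : ℕ := ∑ j, y j

/-- The homogenization `(D - |aᵢ|, aᵢ₁, …, aᵢ_d)` of the vectors `aᵢ` (used when `|aᵢ| ≤ D`). -/
def homogenization {d n : ℕ} (D : ℕ) (a : Fin (n + 1) → Fin d → ℕ) :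
    Fin (n + 1) → Fin (d + 1) → ℕ :=
  fun i => Fin.cons (D - size (a i)) (a i)

/-- The `s`-fold sumset `sA`; in particular `0A = {0}`. -/
def sumset {d : ℕ} (s : ℕ) (A : Set (Fin d → ℕ)) : Set (Fin d → ℕ) :=
  {y | ∃ f : Fin s → Fin d → ℕ, (∀ t, f t ∈ A) ∧ y = ∑ t, f t}

/-- `ℕ_e^d`, the vectors whose coordinate sum is divisible by `e`. -/
def latticeMod (d e : ℕ) : Set (Fin d → ℕ) := {y | e ∣ size y}

/-- `Δ_{s,e}`, the vectors in `ℕ_e^d` with coordinate sum at most `s D`. -/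
def simplexMod (d D s e : ℕ) : Set (Fin d → ℕ) := {y | y ∈ latticeMod d e ∧ size y ≤ s * D}

/-! ### The four conditions -/

/-- The toric variety of the homogenization has exactly one singular point, `(1 : 0 : ⋯ : 0)`. -/
def SingleSingularPoint (k : Type*) [Field k] {d n : ℕ} (D : ℕ) (a : Fin (n + 1) → Fin d → ℕ) :
    Prop :=
  {P | IsSingularPoint (toricVariety k (homogenization D a)) P} = {firstPoint k n}

/-- The shape of the homogenization, for a given `e`. Coordinate `0` of `ℕ^(d+1)` is the
homogenizing one. -/
def HomogenizedShape {d n : ℕ} (D : ℕ) (a : Fin (n + 1) → Fin d → ℕ) (e : ℕ) : Prop :=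
  1 ≤ e ∧ e ≤ D ∧ e ∣ D ∧
    (∀ i j : Fin d, (Pi.single i.succ (D - 1) + Pi.single j.succ 1 : Fin (d + 1) → ℕ) ∈
      Set.range (homogenization D a)) ∧
    (∀ j : Fin d, (Pi.single 0 e + Pi.single j.succ (D - e) : Fin (d + 1) → ℕ) ∈
      Set.range (homogenization D a)) ∧
    (∀ i, e ∣ homogenization D a i 0) ∧
    (e = 1 → ∃ j : Fin d, (Pi.single 0 (D - 1) + Pi.single j.succ 1 : Fin (d + 1) → ℕ) ∉
      Set.range (homogenization D a))

/-- The shape of the set `A = {a₀, …, aₙ}` itself, for a given `e`. -/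
def AffineShape {d n : ℕ} (D : ℕ) (a : Fin (n + 1) → Fin d → ℕ) (e : ℕ) : Prop :=
  1 ≤ e ∧ e ≤ D ∧ e ∣ D ∧
    (0 : Fin d → ℕ) ∈ Set.range a ∧
    (∀ i j : Fin d, (Pi.single i (D - 1) + Pi.single j 1 : Fin d → ℕ) ∈ Set.range a) ∧
    (∀ i : Fin d, (Pi.single i (D - e) : Fin d → ℕ) ∈ Set.range a) ∧
    (∀ i, e ∣ size (a i)) ∧
    (e = 1 → ∃ j : Fin d, (Pi.single j 1 : Fin d → ℕ) ∉ Set.range a)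

/-- The asymptotic structure of the sumsets of `A = {a₀, …, aₙ}`, for a given `e`. -/
def SumsetStructure {d n : ℕ} (D : ℕ) (a : Fin (n + 1) → Fin d → ℕ) (e : ℕ) : Prop :=
  1 ≤ e ∧ ∃ H : Set (Fin d → ℕ), H.Finite ∧ H ⊆ latticeMod d e ∧ (e = 1 → H.Nonempty) ∧
    ∃ s₀ : ℕ, ∀ s, s₀ ≤ s → sumset s (Set.range a) = simplexMod d D s e \ H

end OneSing

end

/-!
A toric ideal is spanned by binomials `x^u - x^u'` with the same `t`-exponent, and its quotient is a
subring of `k[t₀, …, t_d]` over which the latter is integral, so `X` has dimension `d`. On the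
chart of a vertex `D ε_q` the Jacobian rank at that vertex is the number of monomials `x_l x_p^N`
whose exponent has another factorization, so the point is smooth exactly when the semigroup
generated by the differences `b_i - D ε_q` is free on one generator along each edge. Some coordinate
of `X` belonging to a vertex is nonzero at every point, hence the singular locus is decided at the
vertices. If the coordinates have greatest common divisor `1`, smoothness at all the vertices except
`D ε₀` forces the edge generators between these to be `1` and those towards `D ε₀` to be a common
`e`.

On the side of the sumsets, a vector with one large coordinate can be written with as few summands
as its size allows: use `D εⱼ` and `(D - 1) εᵢ + εⱼ`, all of size `D`, and correct along the `i`-th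
axis by `(D - e) εᵢ`. Conversely, in a sum of `s + 1` elements of `A` equal to such a vector plus
`s D εᵢ`, the sizes leave no freedom and the vector itself is one of the summands.
-/

noncomputable section

namespace OneSing
/-! ### Coordinate sums -/

section Size

variable {d : ℕ}

theorem size_zero : size (0 : Fin d → ℕ) = 0 := by simp [size]

theorem size_add (x y : Fin d → ℕ) : size (x + y) = size x + size y := by
  simp [size, Finset.sum_add_distrib]

theorem size_smul (c : ℕ) (x : Fin d → ℕ) : size (c • x) = c * size x := by
  simp [size, Finset.mul_sum]

theorem size_single (i : Fin d) (c : ℕ) : size (Pi.single i c) = c := by simp [size]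

theorem size_sum {ι : Type*} (s : Finset ι) (f : ι → Fin d → ℕ) :
    size (∑ i ∈ s, f i) = ∑ i ∈ s, size (f i) := by
  simp [size, Finset.sum_comm (s := s)]

theorem apply_le_size (y : Fin d → ℕ) (j : Fin d) : y j ≤ size y :=
  Finset.single_le_sum (f := y) (fun _ _ => Nat.zero_le _) (Finset.mem_univ j)

theorem apply_add_sum_erase (y : Fin d → ℕ) (q : Fin d) :
    y q + ∑ j ∈ Finset.univ.erase q, y j = size y :=
  Finset.add_sum_erase _ _ (Finset.mem_univ q)

theorem eq_of_size_eq_of_forall_ne {x y : Fin d → ℕ} (hsize : size x = size y) (q : Fin d)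
    (h : ∀ j, j ≠ q → x j = y j) : x = y := by
  have hrest : ∑ j ∈ Finset.univ.erase q, x j = ∑ j ∈ Finset.univ.erase q, y j :=
    Finset.sum_congr rfl fun j hj => h j (Finset.ne_of_mem_erase hj)
  rw [← apply_add_sum_erase x q, ← apply_add_sum_erase y q, hrest, add_left_inj] at hsize
  ext j
  obtain rfl | hj := eq_or_ne j q
  exacts [hsize, h j hj]

theorem eq_single_of_forall_ne_eq_zero {x : Fin d → ℕ} {q : Fin d} (h : ∀ j, j ≠ q → x j = 0) :
    x = Pi.single q (size x) :=
  eq_of_size_eq_of_forall_ne (size_single _ _).symm q fun j hj => by simp [h j hj, hj]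

end Size

/-! ### Toric ideals -/

theorem ringKrullDim_eq_of_isIntegral {R S : Type*} [CommRing R] [CommRing S] (f : R →+* S)
    (hf : f.IsIntegral) (hinj : Function.Injective f) : ringKrullDim R = ringKrullDim S := by
  algebraize [f]
  apply le_antisymm
  · refine iSup_le fun l => ?_
    obtain ⟨P, -, hP, hPl⟩ := Ideal.exists_ideal_over_prime_of_isIntegral l.head.asIdeal
      (⊥ : Ideal S) (by
        rw [← RingHom.ker_eq_comap_bot,
          (RingHom.injective_iff_ker_eq_bot (algebraMap R S)).mp hinj]
        exact bot_le)
    have : P.LiesOver l.head.asIdeal := ⟨hPl.symm⟩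
    obtain ⟨L, hL, -, -⟩ := Ideal.exists_ltSeries_of_hasGoingUp l P
    rw [← hL]
    exact Order.LTSeries.length_le_krullDim L
  · exact Order.krullDim_le_of_strictMono (PrimeSpectrum.comap (algebraMap R S))
      fun I J h => Ideal.IsIntegral.comap_lt_comap (R := R) h

/-- The linear map `u ↦ ∑ᵢ uᵢ bᵢ`; it sends the exponent of the monomial `x^u` to the exponent of
its image under `xᵢ ↦ t^(bᵢ)`. -/
abbrev toricExponent {ι : Type*} {m : ℕ} (b : ι → Fin m → ℕ) : (ι →₀ ℕ) →ₗ[ℕ] (Fin m → ℕ) :=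
  Finsupp.linearCombination ℕ b

section Exponent

variable {ι : Type*} {m D : ℕ} {b : ι → Fin m → ℕ} {u u' : ι →₀ ℕ}

theorem toricExponent_apply (u : ι →₀ ℕ) (j : Fin m) :
    toricExponent b u j = ∑ i ∈ u.support, u i * b i j := by
  rw [Finsupp.linearCombination_apply, Finsupp.sum, Finset.sum_apply]
  rfl

theorem mul_le_toricExponent (u : ι →₀ ℕ) (i : ι) (j : Fin m) :
    u i * b i j ≤ toricExponent b u j := by
  obtain hi | hi := eq_or_ne (u i) 0
  · simp [hi]
  · rw [toricExponent_apply]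
    exact Finset.single_le_sum (f := fun i => u i * b i j) (fun _ _ => Nat.zero_le _)
      (Finsupp.mem_support_iff.mpr hi)

theorem size_toricExponent (hsum : ∀ i, size (b i) = D) (u : ι →₀ ℕ) :
    size (toricExponent b u) = u.degree * D := by
  rw [Finsupp.linearCombination_apply, Finsupp.sum, size_sum, Finsupp.degree_apply, Finset.sum_mul]
  simp only [size_smul, hsum]

theorem degree_eq_of_toricExponent_eq (hD : 0 < D) (hsum : ∀ i, size (b i) = D)
    (h : toricExponent b u = toricExponent b u') : u.degree = u'.degree := by
  have := congrArg size h
  rw [size_toricExponent hsum, size_toricExponent hsum] at this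
  exact Nat.eq_of_mul_eq_mul_right hD this

theorem toricExponent_eq_of_degree_eq (hsum : ∀ i, size (b i) = D) (q : Fin m)
    (hdeg : u.degree = u'.degree)
    (h : ∀ j, j ≠ q → toricExponent b u j = toricExponent b u' j) :
    toricExponent b u = toricExponent b u' :=
  eq_of_size_eq_of_forall_ne (by rw [size_toricExponent hsum, size_toricExponent hsum, hdeg]) q h

theorem toricExponent_single_add_single_apply {p : ι} {q j : Fin m} (hp : b p = Pi.single q D)
    (hj : j ≠ q) (l : ι) (N : ℕ) :
    toricExponent b (Finsupp.single l 1 + Finsupp.single p N) j = b l j := by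
  simp [hp, hj]

end Exponent

/-- The homomorphism `k[x₀, …, xₙ] → k[t₁, …, t_m]`, `xᵢ ↦ t^(bᵢ)`, whose kernel is the toric
ideal of `b`. -/
abbrev toricMap (k : Type*) [Field k] {n m : ℕ} (b : Fin (n + 1) → Fin m → ℕ) :
    MvPolynomial (Fin (n + 1)) k →ₐ[k] MvPolynomial (Fin m) k :=
  aeval fun i => ∏ j, X j ^ b i j

section ToricIdeal

variable {k : Type*} [Field k] {n m D : ℕ} {b : Fin (n + 1) → Fin m → ℕ}
  {f : MvPolynomial (Fin (n + 1)) k}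

theorem mem_toricIdeal : f ∈ toricIdeal k b ↔ toricMap k b f = 0 := Iff.rfl

theorem toricMap_monomial (u : Fin (n + 1) →₀ ℕ) :
    toricMap k b (monomial u 1) =
      monomial (Finsupp.equivFunOnFinite.symm (toricExponent b u)) 1 := by
  rw [aeval_monomial, map_one, one_mul, Finsupp.prod, monomial_eq, map_one, one_mul,
    Finsupp.prod_fintype _ _ (by simp)]
  simp only [Finsupp.coe_equivFunOnFinite_symm, toricExponent_apply, ← Finset.prod_pow, ← pow_mul]
  rw [Finset.prod_comm]
  simp only [Finset.prod_pow_eq_pow_sum, mul_comm]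

theorem monomial_sub_monomial_mem_toricIdeal {u u' : Fin (n + 1) →₀ ℕ}
    (h : toricExponent b u = toricExponent b u') :
    monomial u 1 - monomial u' 1 ∈ toricIdeal k b := by
  rw [mem_toricIdeal, map_sub, toricMap_monomial, toricMap_monomial, h, sub_self]

-- `L` factors through `toricMap k b`, hence vanishes on its kernel.
theorem map_eq_zero_of_mem_toricIdeal {M : Type*} [AddCommMonoid M] [Module k M]
    (L : MvPolynomial (Fin (n + 1)) k →ₗ[k] M)
    (hL : ∀ u u', toricExponent b u = toricExponent b u' →
      L (monomial u 1) = L (monomial u' 1)) (hf : f ∈ toricIdeal k b) : L f = 0 := by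
  let value : (Fin m → ℕ) → M :=
    Function.extend (toricExponent b) (fun u => L (monomial u 1)) 0
  let L' : MvPolynomial (Fin m) k →ₗ[k] M :=
    (basisMonomials (Fin m) k).constr ℕ fun w => value w
  have hfactor : L = L' ∘ₗ (toricMap k b).toLinearMap := by
    refine (basisMonomials _ k).ext fun u => ?_
    have hextend : value (toricExponent b u) = L (monomial u 1) :=
      Function.FactorsThrough.extend_apply (fun u u' h => hL u u' h) _ u
    rw [coe_basisMonomials, LinearMap.comp_apply, AlgHom.toLinearMap_apply, toricMap_monomial,
      ← hextend]
    exact (congrArg value (Finsupp.coe_equivFunOnFinite_symm _).symm).trans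
      ((basisMonomials (Fin m) k).constr_basis ℕ (fun w => value w) _).symm
  rw [hfactor, LinearMap.comp_apply, AlgHom.toLinearMap_apply, mem_toricIdeal.mp hf, map_zero]

theorem mem_zeroLocus_toricIdeal_iff {v : Fin (n + 1) → k} :
    v ∈ zeroLocus k (toricIdeal k b) ↔ ∀ u u', toricExponent b u = toricExponent b u' →
      eval v (monomial u 1) = eval v (monomial u' 1) := by
  constructor
  · intro hv u u' h
    rw [← sub_eq_zero, ← map_sub]
    exact hv _ (monomial_sub_monomial_mem_toricIdeal h)
  · intro hv f hf
    exact map_eq_zero_of_mem_toricIdeal (aeval v).toLinearMap hv hf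

theorem isIntegral_kerLift_toricMap (hD : 0 < D) (hvert : ∀ j, Pi.single j D ∈ Set.range b) :
    (RingHom.kerLift (toricMap k b).toRingHom).IsIntegral := by
  set φ := (toricMap k b).toRingHom
  have himage : ∀ x, (RingHom.kerLift φ).IsIntegralElem (φ x) := fun x => by
    rw [← RingHom.kerLift_mk φ x]
    exact RingHom.isIntegralElem_map _
  intro g
  induction g using MvPolynomial.induction_on with
  | C c => simpa [φ] using himage (C c)
  | add g g' hg hg' => exact hg.add _ hg'
  | mul_X g j hg =>
    refine hg.mul _ ?_
    obtain ⟨i, hi⟩ := hvert j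
    have hX : φ (X i) = X j ^ D := by
      simp only [φ, AlgHom.toRingHom_eq_coe, RingHom.coe_coe, aeval_X, hi]
      rw [Finset.prod_eq_single j] <;> simp +contextual
    have hpow := himage (X i)
    rw [hX] at hpow
    let _ := (RingHom.kerLift φ).toAlgebra
    exact IsIntegral.of_pow (R := MvPolynomial (Fin (n + 1)) k ⧸ RingHom.ker φ) hD hpow

theorem ringKrullDim_quotient_toricIdeal (hD : 0 < D)
    (hvert : ∀ j, Pi.single j D ∈ Set.range b) :
    ringKrullDim (MvPolynomial (Fin (n + 1)) k ⧸ toricIdeal k b) = m := by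
  refine (ringKrullDim_eq_of_isIntegral _ (isIntegral_kerLift_toricMap hD hvert)
    (RingHom.kerLift_injective (toricMap k b).toRingHom)).trans ?_
  rw [MvPolynomial.ringKrullDim_of_isNoetherianRing, ringKrullDim_eq_zero_of_field]
  simp

end ToricIdeal

/-! ### Points of projective toric varieties -/

section ToricVariety

variable {k : Type*} [Field k] {n m D : ℕ} {b : Fin (n + 1) → Fin m → ℕ}
  {P : Projectivization k (Fin (n + 1) → k)} {v : Fin (n + 1) → k}

theorem eval_smul_monomial {σ : Type*} (c : k) (v : σ → k) (u : σ →₀ ℕ) :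
    eval (c • v) (monomial u 1) = c ^ u.degree * eval v (monomial u 1) := by
  simp [eval_monomial, Finsupp.prod, mul_pow, Finset.prod_mul_distrib,
    Finset.prod_pow_eq_pow_sum, Finsupp.degree_apply]

theorem smul_mem_zeroLocus_toricIdeal (hD : 0 < D) (hsum : ∀ i, size (b i) = D) (c : k)
    (hv : v ∈ zeroLocus k (toricIdeal k b)) : c • v ∈ zeroLocus k (toricIdeal k b) :=
  mem_zeroLocus_toricIdeal_iff.mpr fun u u' h => by
    rw [eval_smul_monomial, eval_smul_monomial, degree_eq_of_toricExponent_eq hD hsum h,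
      mem_zeroLocus_toricIdeal_iff.mp hv u u' h]

theorem mk_mem_toricVariety_iff (hD : 0 < D) (hsum : ∀ i, size (b i) = D) (hv : v ≠ 0) :
    Projectivization.mk k v hv ∈ toricVariety k b ↔ v ∈ zeroLocus k (toricIdeal k b) := by
  simp only [toricVariety, projZeroLocus, Set.mem_ofPred_eq, Projectivization.submodule_mk]
  refine ⟨fun h => h (Submodule.mem_span_singleton_self v), fun h w hw => ?_⟩
  obtain ⟨c, rfl⟩ := Submodule.mem_span_singleton.mp hw
  exact smul_mem_zeroLocus_toricIdeal hD hsum c h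

theorem rep_mem_zeroLocus (hP : P ∈ toricVariety k b) : P.rep ∈ zeroLocus k (toricIdeal k b) :=
  hP (by simp [P.submodule_eq, Submodule.mem_span_singleton_self])

theorem aeval_monomialPoint (t : Fin m → k) (f : MvPolynomial (Fin (n + 1)) k) :
    aeval (fun i => ∏ j, t j ^ b i j) f = aeval t (toricMap k b f) := by
  rw [← AlgHom.comp_apply]
  congr 1
  exact algHom_ext fun i => by simp

theorem monomialPoint_mem_zeroLocus (t : Fin m → k) :
    (fun i => ∏ j, t j ^ b i j) ∈ zeroLocus k (toricIdeal k b) := fun f hf => by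
  rw [aeval_monomialPoint, mem_toricIdeal.mp hf, map_zero]

theorem affineCone_toricVariety (hD : 0 < D) (hsum : ∀ i, size (b i) = D)
    (hne : (toricVariety k b).Nonempty) :
    affineCone (toricVariety k b) = zeroLocus k (toricIdeal k b) := by
  ext v
  refine ⟨fun ⟨_, hP, hv⟩ => hP hv, fun hv => ?_⟩
  obtain rfl | h0 := eq_or_ne v 0
  · obtain ⟨P, hP⟩ := hne
    exact ⟨P, hP, zero_mem _⟩
  · refine ⟨_, (mk_mem_toricVariety_iff hD hsum h0).mpr hv, ?_⟩
    rw [Projectivization.submodule_mk]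
    exact Submodule.mem_span_singleton_self v

theorem projVanishingIdeal_toricVariety [Infinite k] (hD : 0 < D) (hsum : ∀ i, size (b i) = D)
    (hne : (toricVariety k b).Nonempty) :
    projVanishingIdeal (toricVariety k b) = toricIdeal k b := by
  rw [projVanishingIdeal, affineCone_toricVariety hD hsum hne]
  refine le_antisymm (fun f hf => ?_) fun f hf v hv => hv f hf
  refine mem_toricIdeal.mpr (MvPolynomial.funext fun t => ?_)
  rw [map_zero, ← hf _ (monomialPoint_mem_zeroLocus t), aeval_monomialPoint]
  rfl

theorem isSingularPoint_toricVariety_iff [Infinite k] (hD : 0 < D) (hsum : ∀ i, size (b i) = D)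
    (hvert : ∀ j, Pi.single j D ∈ Set.range b) :
    IsSingularPoint (toricVariety k b) P ↔ P ∈ toricVariety k b ∧
      Module.finrank k (jacobianSpan (toricIdeal k b) P.rep) + m < n + 1 := by
  refine and_congr_right fun hP => ?_
  rw [projVanishingIdeal_toricVariety hD hsum ⟨P, hP⟩, ringKrullDim_quotient_toricIdeal hD hvert]
  norm_cast

end ToricVariety
/-! ### The rank of the Jacobian matrix -/

section Jacobian

variable {k : Type*} [Field k] {n : ℕ} {I : Ideal (MvPolynomial (Fin (n + 1)) k)}
  {v : Fin (n + 1) → k}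

theorem finrank_jacobianSpan_add_card_le (T : Finset (Fin (n + 1)))
    (hT : ∀ l ∈ T, ∀ f ∈ I, eval v (pderiv l f) = 0) :
    Module.finrank k (jacobianSpan I v) + T.card ≤ n + 1 := by
  let restrict : (Fin (n + 1) → k) →ₗ[k] (T → k) := LinearMap.funLeft k k Subtype.val
  have hsurj : LinearMap.range restrict = ⊤ := LinearMap.range_eq_top.mpr
    (LinearMap.funLeft_surjective_of_injective k k _ Subtype.val_injective)
  have hker : jacobianSpan I v ≤ LinearMap.ker restrict := by
    refine Submodule.span_le.mpr ?_
    rintro _ ⟨f, hf, rfl⟩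
    exact funext fun l => hT l l.2 f hf
  have hrank := restrict.finrank_range_add_finrank_ker
  rw [hsurj, finrank_top, Module.finrank_fintype_fun_eq_card, Fintype.card_coe,
    Module.finrank_fin_fun] at hrank
  have := Submodule.finrank_mono hker
  omega

theorem le_finrank_jacobianSpan_add_card (S : Finset (Fin (n + 1)))
    (hS : ∀ l ∉ S, ∃ f ∈ I, eval v (pderiv l f) ≠ 0 ∧
      ∀ i ∉ S, i ≠ l → eval v (pderiv i f) = 0) :
    n + 1 ≤ Module.finrank k (jacobianSpan I v) + S.card := by
  let restrict : (Fin (n + 1) → k) →ₗ[k] ((Sᶜ : Finset (Fin (n + 1))) → k) :=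
    LinearMap.funLeft k k Subtype.val
  have hmap : (jacobianSpan I v).map restrict = ⊤ := by
    rw [eq_top_iff, ← (Pi.basisFun k _).span_eq, Submodule.span_le]
    rintro _ ⟨l, rfl⟩
    obtain ⟨f, hf, hl, hne⟩ := hS l (Finset.mem_compl.mp l.2)
    refine ⟨(eval v (pderiv l.1 f))⁻¹ • fun i => eval v (pderiv i f),
      Submodule.smul_mem _ _ (Submodule.subset_span ⟨f, hf, rfl⟩), funext fun i => ?_⟩
    obtain rfl | hi := eq_or_ne i l
    · simp [restrict, LinearMap.funLeft_apply, hl]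
    · simp [restrict, LinearMap.funLeft_apply, hi,
        hne i (Finset.mem_compl.mp i.2) (Subtype.coe_ne_coe.mpr hi)]
  have hrank := Submodule.finrank_map_le restrict (jacobianSpan I v)
  rw [hmap, finrank_top, Module.finrank_fintype_fun_eq_card, Fintype.card_coe,
    Finset.card_compl, Fintype.card_fin] at hrank
  omega

-- The binomials `x_l x_p ^ N - x ^ c` have linearly independent gradients at `v`.
theorem le_finrank_jacobianSpan_toricIdeal_add_card {m : ℕ} {b : Fin (n + 1) → Fin m → ℕ}
    {S : Finset (Fin (n + 1))} {p : Fin (n + 1)} (hpS : p ∈ S) (hv : v p ≠ 0)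
    (hS : ∀ l ∉ S, ∃ N c, c.support ⊆ S ∧
      toricExponent b (Finsupp.single l 1 + Finsupp.single p N) = toricExponent b c) :
    n + 1 ≤ Module.finrank k (jacobianSpan (toricIdeal k b) v) + S.card := by
  refine le_finrank_jacobianSpan_add_card S fun l hl => ?_
  obtain ⟨N, c, hc, h⟩ := hS l hl
  have hpl : p ≠ l := ne_of_mem_of_not_mem hpS hl
  have hc0 : ∀ i ∉ S, c i = 0 := fun i hi => Finsupp.notMem_support_iff.mp fun h => hi (hc h)
  refine ⟨_, monomial_sub_monomial_mem_toricIdeal h, ?_, fun i hi hil => ?_⟩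
  · simp [pderiv_monomial, hc0 l hl, hpl, hv, eval_monomial]
  · have hpi : p ≠ i := ne_of_mem_of_not_mem hpS hi
    simp [pderiv_monomial, hc0 i hi, hpi, hil.symm]

end Jacobian

/-! ### Vertices -/

/-- The monomials `x_l x_p ^ N` are the only ones with their exponent. When `b p` is a vertex this
says that `b l - b p` is irreducible (or zero) in the semigroup generated by all `b i - b p`. -/
def IsIsolated {ι : Type*} {m : ℕ} (b : ι → Fin m → ℕ) (p l : ι) : Prop :=
  ∀ N u, toricExponent b u = toricExponent b (Finsupp.single l 1 + Finsupp.single p N) →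
    u = Finsupp.single l 1 + Finsupp.single p N

/-- `g` generates the edge of the simplex of side `D` from the vertex `q` to the vertex `j`: the
point of the edge at distance `g` from `q` is a row, and `g` divides the `j`-th entry of every
row. -/
def IsEdgeGenerator {ι : Type*} {m : ℕ} (b : ι → Fin m → ℕ) (D : ℕ) (q j : Fin m) (g : ℕ) :
    Prop :=
  g ≠ 0 ∧ g ≤ D ∧ Pi.single q (D - g) + Pi.single j g ∈ Set.range b ∧ ∀ l, g ∣ b l j

/-- The semigroup generated by the differences of the rows and the vertex `D ε_q` is free: its
generators are the edge generators. -/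
def IsSmoothVertex {ι : Type*} {m : ℕ} (b : ι → Fin m → ℕ) (D : ℕ) (q : Fin m) : Prop :=
  ∀ j, j ≠ q → ∃ g, IsEdgeGenerator b D q j g

section Vertex

variable {ι : Type*} {m D : ℕ} {b : ι → Fin m → ℕ} {p l : ι} {q j : Fin m}
  {u : ι →₀ ℕ}

theorem eq_single_of_toricExponent_eq (hb : Function.Injective b) (hD : 0 < D)
    (hsum : ∀ i, size (b i) = D) (hp : b p = Pi.single q D) {N : ℕ}
    (h : toricExponent b u = toricExponent b (Finsupp.single p N)) : u = Finsupp.single p N := by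
  have hsupp : ∀ i, u i ≠ 0 → i = p := fun i hi => hb <| by
    rw [hp, ← hsum i]
    refine eq_single_of_forall_ne_eq_zero fun j hj => ?_
    have := mul_le_toricExponent (b := b) u i j
    rw [h, Finsupp.linearCombination_single, hp] at this
    simpa [hj, hi] using this
  have hu : u = Finsupp.single p (u p) := by
    ext i
    obtain rfl | hi := eq_or_ne i p
    · simp
    · rw [Finsupp.single_eq_of_ne hi]
      exact not_imp_comm.mp (hsupp i) hi
  have hdeg := degree_eq_of_toricExponent_eq hD hsum h
  rw [hu, Finsupp.degree_single, Finsupp.degree_single] at hdeg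
  rw [hu, hdeg]

theorem eq_single_add_single_of_toricExponent_eq (hb : Function.Injective b) (hD : 0 < D)
    (hsum : ∀ i, size (b i) = D) (hp : b p = Pi.single q D) {N : ℕ}
    (h : toricExponent b u = toricExponent b (Finsupp.single l 1 + Finsupp.single p N))
    (hul : u l ≠ 0) : u = Finsupp.single l 1 + Finsupp.single p N := by
  have hsplit : Finsupp.single l 1 + (u - Finsupp.single l 1) = u :=
    add_tsub_cancel_of_le (Finsupp.single_le_iff.mpr (Nat.one_le_iff_ne_zero.mpr hul))
  rw [← hsplit, map_add, map_add, add_right_inj] at h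
  rw [← hsplit, eq_single_of_toricExponent_eq hb hD hsum hp h]

theorem isIsolated_self (hb : Function.Injective b) (hD : 0 < D) (hsum : ∀ i, size (b i) = D)
    (hp : b p = Pi.single q D) : IsIsolated b p p := fun N u h => by
  rw [← Finsupp.single_add] at h ⊢
  exact eq_single_of_toricExponent_eq hb hD hsum hp h

theorem eq_single_add_single_of_forall_ne_eq_zero {x : Fin m → ℕ} (hjq : j ≠ q)
    (h : ∀ t, t ≠ q → t ≠ j → x t = 0) :
    x = Pi.single q (size x - x j) + Pi.single j (x j) := by
  refine eq_of_size_eq_of_forall_ne ?_ q fun t htq => ?_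
  · rw [size_add, size_single, size_single, Nat.sub_add_cancel (apply_le_size x j)]
  · obtain rfl | htj := eq_or_ne t j
    · simp [htq]
    · simp [htq, htj, h t htq htj]

theorem isIsolated_of_first_on_edge (hb : Function.Injective b) (hD : 0 < D)
    (hsum : ∀ i, size (b i) = D) (hp : b p = Pi.single q D) (hjq : j ≠ q) {g : ℕ} (hg : g ≠ 0)
    (hl : b l = Pi.single q (D - g) + Pi.single j g)
    (hfirst : ∀ g' ≠ 0, Pi.single q (D - g') + Pi.single j g' ∈ Set.range b → g ≤ g') :
    IsIsolated b p l := fun N u h => by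
  have hexp : ∀ t, t ≠ q → toricExponent b u t = (Pi.single j g : Fin m → ℕ) t :=
    fun t htq => by simp [h, toricExponent_single_add_single_apply hp htq, hl, htq]
  have hexpj : ∑ i ∈ u.support, u i * b i j = g := by
    rw [← toricExponent_apply, hexp j hjq, Pi.single_eq_same]
  obtain ⟨i, -, hi⟩ := Finset.exists_ne_zero_of_sum_ne_zero (hexpj.trans_ne hg)
  obtain ⟨hui, hbij⟩ := mul_ne_zero_iff.mp hi
  have hbi : b i = Pi.single q (D - b i j) + Pi.single j (b i j) := by
    rw [← hsum i]
    refine eq_single_add_single_of_forall_ne_eq_zero hjq fun t htq htj => ?_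
    have := (mul_le_toricExponent u i t).trans_eq (hexp t htq)
    simpa [htj, hui] using this
  have hle : b i j ≤ g := by
    have := (mul_le_toricExponent u i j).trans_eq (hexp j hjq)
    rw [Pi.single_eq_same] at this
    exact (Nat.le_mul_of_pos_left _ (Nat.pos_of_ne_zero hui)).trans this
  have hgi : b i j = g := le_antisymm hle (hfirst _ hbij ⟨i, hbi⟩)
  obtain rfl : i = l := hb (by rw [hbi, hl, hgi])
  exact eq_single_add_single_of_toricExponent_eq hb hD hsum hp h hui

theorem exists_isIsolated_on_edge (hb : Function.Injective b) (hD : 0 < D)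
    (hsum : ∀ i, size (b i) = D) (hvert : ∀ j, Pi.single j D ∈ Set.range b)
    (hp : b p = Pi.single q D) (hjq : j ≠ q) :
    ∃ g l, g ≠ 0 ∧ g ≤ D ∧ b l = Pi.single q (D - g) + Pi.single j g ∧ IsIsolated b p l := by
  classical
  have hex : ∃ g ≠ 0, Pi.single q (D - g) + Pi.single j g ∈ Set.range b :=
    ⟨D, hD.ne', by simpa using hvert j⟩
  obtain ⟨hg, l, hl⟩ := Nat.find_spec hex
  refine ⟨Nat.find hex, l, hg, Nat.find_min' hex ⟨hD.ne', by simpa using hvert j⟩, hl,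
    isIsolated_of_first_on_edge hb hD hsum hp hjq hg hl fun g' hg' hmem => ?_⟩
  exact Nat.find_min' hex ⟨hg', hmem⟩

-- A row that is not isolated is, off the coordinate `q`, a sum of rows closer to the vertex.
theorem dvd_of_forall_isIsolated_dvd (hb : Function.Injective b) (hD : 0 < D)
    (hsum : ∀ i, size (b i) = D) (hp : b p = Pi.single q D) (hjq : j ≠ q) {g : ℕ}
    (hg : ∀ l, IsIsolated b p l → g ∣ b l j) (l : ι) : g ∣ b l j := by
  induction hw : D - b l q using Nat.strong_induction_on generalizing l with
  | _ w ih =>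
  by_cases hl : IsIsolated b p l
  · exact hg l hl
  simp only [IsIsolated, not_forall] at hl
  obtain ⟨N, u, h, hne⟩ := hl
  have hul : u l = 0 :=
    not_imp_comm.mp (eq_single_add_single_of_toricExponent_eq hb hD hsum hp h) hne
  have hexp : ∀ t, t ≠ q → toricExponent b u t = b l t := fun t htq => by
    rw [h, toricExponent_single_add_single_apply hp htq]
  rw [← hexp j hjq, toricExponent_apply]
  refine Finset.dvd_sum fun i _ => ?_
  obtain hui | hui := eq_or_ne (u i) 0
  · simp [hui]
  have hcloser : b l q < b i q := by
    by_contra! hle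
    have hle' : ∀ t, b i t ≤ b l t := fun t => by
      obtain rfl | htq := eq_or_ne t q
      · exact hle
      · rw [← hexp t htq]
        exact (Nat.le_mul_of_pos_left _ (Nat.pos_of_ne_zero hui)).trans
          (mul_le_toricExponent u i t)
    have hsame := (Finset.sum_eq_sum_iff_of_le fun t _ => hle' t).mp ((hsum i).trans (hsum l).symm)
    obtain rfl : i = l := hb (funext fun t => hsame t (Finset.mem_univ t))
    exact hui hul
  have hiD : b i q ≤ D := hsum i ▸ apply_le_size _ q
  exact Dvd.dvd.mul_left (ih _ (by omega) i rfl) _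

end Vertex

theorem injective_of_forall_apply_eq_single {ι : Type*} {m : ℕ} {b : ι → Fin m → ℕ} {q : Fin m}
    {g : Fin m → ℕ} (hg : ∀ j, j ≠ q → g j ≠ 0) {B : Fin m → ι}
    (hB : ∀ i j, j ≠ q → b (B i) j = (Pi.single i (g i) : Fin m → ℕ) j) :
    Function.Injective B := by
  have heq : ∀ x y, B x = B y → x ≠ q → x = y := fun x y hxy hx => by
    by_contra hne
    have := hB x x hx
    rw [hxy, hB y x hx] at this
    simp [hne, (hg x hx).symm] at this
  intro x y hxy
  by_contra hne
  obtain rfl | hx := eq_or_ne x q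
  · exact hne (heq y x hxy.symm (Ne.symm hne)).symm
  · exact hne (heq x y hxy hx)

section VertexPoint

variable {k : Type*} [Field k] {n m D : ℕ} {b : Fin (n + 1) → Fin m → ℕ} {p l : Fin (n + 1)}
  {q : Fin m} {u : Fin (n + 1) →₀ ℕ} {v : Fin (n + 1) → k}

theorem eval_single_monomial_eq_zero (c r : k) (hu : ∀ N, u ≠ Finsupp.single p N) :
    eval (Pi.single p c) (monomial u r) = 0 := by
  obtain ⟨i, hip, hi⟩ : ∃ i, i ≠ p ∧ u i ≠ 0 := by
    by_contra! h
    refine hu (u p) (Finsupp.ext fun i => ?_)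
    obtain rfl | hip := eq_or_ne i p
    · simp
    · simp [h i hip, hip]
  rw [eval_monomial, Finsupp.prod_fintype _ _ (by simp),
    Finset.prod_eq_zero (Finset.mem_univ i) (by simp [hip, hi]), mul_zero]

theorem eval_single_pderiv_monomial_eq_zero (c r : k)
    (hu : ∀ N, u ≠ Finsupp.single l 1 + Finsupp.single p N) :
    eval (Pi.single p c) (pderiv l (monomial u r)) = 0 := by
  rw [pderiv_monomial]
  obtain hul | hul := eq_or_ne (u l) 0
  · simp [hul]
  · refine eval_single_monomial_eq_zero _ _ fun N hN => hu N ?_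
    rw [← hN, add_tsub_cancel_of_le
      (Finsupp.single_le_iff.mpr (Nat.one_le_iff_ne_zero.mpr hul))]

theorem single_mem_zeroLocus_toricIdeal (hb : Function.Injective b) (hD : 0 < D)
    (hsum : ∀ i, size (b i) = D) (hp : b p = Pi.single q D) (c : k) :
    Pi.single p c ∈ zeroLocus k (toricIdeal k b) := by
  refine mem_zeroLocus_toricIdeal_iff.mpr fun u u' h => ?_
  by_cases hu : ∃ N, u = Finsupp.single p N
  · obtain ⟨N, rfl⟩ := hu
    rw [eq_single_of_toricExponent_eq hb hD hsum hp h.symm]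
  by_cases hu' : ∃ N, u' = Finsupp.single p N
  · obtain ⟨N, rfl⟩ := hu'
    rw [eq_single_of_toricExponent_eq hb hD hsum hp h]
  rw [eval_single_monomial_eq_zero c 1 (not_exists.mp hu),
    eval_single_monomial_eq_zero c 1 (not_exists.mp hu')]

theorem eval_single_pderiv_eq_zero_of_isIsolated (hl : IsIsolated b p l) (c : k)
    {f : MvPolynomial (Fin (n + 1)) k} (hf : f ∈ toricIdeal k b) :
    eval (Pi.single p c) (pderiv l f) = 0 := by
  refine map_eq_zero_of_mem_toricIdeal
    ((aeval (Pi.single p c)).toLinearMap ∘ₗ (pderiv l).toLinearMap) (fun u u' h => ?_) hf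
  change eval (Pi.single p c) (pderiv l (monomial u 1)) =
    eval (Pi.single p c) (pderiv l (monomial u' 1))
  by_cases hu : ∃ N, u = Finsupp.single l 1 + Finsupp.single p N
  · obtain ⟨N, rfl⟩ := hu
    rw [hl N u' h.symm]
  by_cases hu' : ∃ N, u' = Finsupp.single l 1 + Finsupp.single p N
  · obtain ⟨N, rfl⟩ := hu'
    rw [hl N u h]
  rw [eval_single_pderiv_monomial_eq_zero c 1 (not_exists.mp hu),
    eval_single_pderiv_monomial_eq_zero c 1 (not_exists.mp hu')]

theorem card_le_of_forall_isIsolated (c : k)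
    (hrank : n + 1 ≤ Module.finrank k (jacobianSpan (toricIdeal k b) (Pi.single p c)) + m)
    {T : Finset (Fin (n + 1))} (hT : ∀ l ∈ T, IsIsolated b p l) : T.card ≤ m := by
  have := finrank_jacobianSpan_add_card_le (v := Pi.single p c) T fun l hl f hf =>
    eval_single_pderiv_eq_zero_of_isIsolated (hT l hl) c hf
  omega

-- The vertex and the first points of its edges are `m` isolated rows, so there are no others.
theorem isSmoothVertex_of_le_finrank (hb : Function.Injective b) (hD : 0 < D)
    (hsum : ∀ i, size (b i) = D) (hvert : ∀ j, Pi.single j D ∈ Set.range b)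
    (hp : b p = Pi.single q D) (c : k)
    (hrank : n + 1 ≤ Module.finrank k (jacobianSpan (toricIdeal k b) (Pi.single p c)) + m) :
    IsSmoothVertex b D q := by
  classical
  choose! g E hg hgD hE hiso using
    fun j (hj : j ≠ q) => exists_isIsolated_on_edge hb hD hsum hvert hp hj
  let B := Function.update E q p
  have hBiso : ∀ i, IsIsolated b p (B i) := fun i => by
    obtain rfl | hi := eq_or_ne i q
    · simpa [B] using isIsolated_self hb hD hsum hp
    · simpa [B, hi] using hiso i hi
  have hB : ∀ i j, j ≠ q → b (B i) j = (Pi.single i (g i) : Fin m → ℕ) j := fun i j hj => by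
    obtain rfl | hi := eq_or_ne i q
    · simp [B, hp, hj]
    · simp [B, hi, hE i hi, hj]
  have hall : ∀ l, IsIsolated b p l → ∃ i, B i = l := fun l hl => by
    by_contra hl'
    have hcard := card_le_of_forall_isIsolated c hrank (T := insert l (Finset.univ.image B))
      (by simp [hl, hBiso])
    rw [Finset.card_insert_of_notMem (by simpa using hl'),
      Finset.card_image_of_injective _ (injective_of_forall_apply_eq_single hg hB),
      Finset.card_univ, Fintype.card_fin] at hcard
    omega
  refine fun j hj => ⟨g j, hg j hj, hgD j hj, ⟨E j, hE j hj⟩,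
    dvd_of_forall_isIsolated_dvd hb hD hsum hp hj fun l hl => ?_⟩
  obtain ⟨i, rfl⟩ := hall l hl
  rw [hB i j hj]
  obtain rfl | hij := eq_or_ne i j <;> simp [*, Ne.symm]

theorem IsSmoothVertex.le_finrank (hsmooth : IsSmoothVertex b D q) (hsum : ∀ i, size (b i) = D)
    (hp : b p = Pi.single q D) (hv : v p ≠ 0) :
    n + 1 ≤ Module.finrank k (jacobianSpan (toricIdeal k b) v) + m := by
  classical
  choose! g hg using hsmooth
  choose! E hE using fun j (hj : j ≠ q) => (hg j hj).2.2.1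
  let edges := (Finset.univ.erase q).image E
  have hcard : (insert p edges).card ≤ m := by
    have h1 := Finset.card_insert_le p edges
    have h2 : edges.card ≤ m - 1 := by
      simpa [edges] using Finset.card_image_le (s := Finset.univ.erase q) (f := E)
    have := q.pos
    omega
  refine (le_finrank_jacobianSpan_toricIdeal_add_card (Finset.mem_insert_self p edges) hv
    fun l _ => ?_).trans (Nat.add_le_add_left hcard _)
  refine ⟨∑ j ∈ Finset.univ.erase q, b l j / g j,
    Finsupp.single p 1 + ∑ j ∈ Finset.univ.erase q, Finsupp.single (E j) (b l j / g j), ?_,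
    toricExponent_eq_of_degree_eq hsum q ?_ fun t ht => ?_⟩
  · refine Finsupp.support_add.trans (Finset.union_subset_iff.mpr ⟨?_, ?_⟩)
    · exact Finsupp.support_single_subset.trans (by simp)
    · refine Finsupp.support_finsetSum.trans (Finset.biUnion_subset.mpr fun j hj => ?_)
      refine Finsupp.support_single_subset.trans (Finset.singleton_subset_iff.mpr ?_)
      exact Finset.mem_insert_of_mem (Finset.mem_image_of_mem E hj)
  · simp
  · rw [toricExponent_single_add_single_apply hp ht, map_add, map_sum]
    simp only [Finsupp.linearCombination_single, hp, one_smul, Pi.add_apply, Finset.sum_apply,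
      Pi.smul_apply, smul_eq_mul, Pi.single_eq_of_ne ht, zero_add]
    rw [Finset.sum_eq_single_of_mem t (by simp [ht]), hE t ht]
    · simp [ht, Nat.div_mul_cancel ((hg t ht).2.2.2 l)]
    · intro j hj hjt
      rw [hE j (Finset.ne_of_mem_erase hj)]
      simp [ht, hjt.symm]

theorem apply_eq_zero_of_vertices_eq_zero (hb : Function.Injective b) (hsum : ∀ i, size (b i) = D)
    (hvert : ∀ j, Pi.single j D ∈ Set.range b) (hp : b p = Pi.single q D)
    (hv : v ∈ zeroLocus k (toricIdeal k b))
    (h0 : ∀ j, j ≠ q → ∀ i, b i = Pi.single j D → v i = 0) (hl : l ≠ p) : v l = 0 := by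
  choose P hP using hvert
  obtain ⟨j, hj, hlj⟩ : ∃ j, j ≠ q ∧ b l j ≠ 0 := by
    by_contra! h
    refine hl (hb ?_)
    rw [eq_single_of_forall_ne_eq_zero h, hsum, hp]
  have hexp : toricExponent b (Finsupp.single l D) =
      toricExponent b (∑ j, Finsupp.single (P j) (b l j)) := by
    simp only [map_sum, Finsupp.linearCombination_single, hP]
    ext t
    simp [Finset.sum_apply, Pi.single_apply, mul_comm]
  have hpow := mem_zeroLocus_toricIdeal_iff.mp hv _ _ hexp
  rw [monomial_sum_one, map_prod, Finset.prod_eq_zero (Finset.mem_univ j)] at hpow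
  · exact eq_zero_of_pow_eq_zero (n := D) (by simpa [eval_monomial] using hpow)
  · simp [eval_monomial, h0 j hj _ (hP j), hlj]

end VertexPoint

/-! ### Singular points -/

/-- The point of `ℙⁿ(k)` whose only nonzero coordinate has index `p`. -/
def coordinatePoint (k : Type*) [Field k] {n : ℕ} (p : Fin (n + 1)) :
    Projectivization k (Fin (n + 1) → k) :=
  Projectivization.mk k (Pi.single p 1) (by simp)

section CoordinatePoint

variable {k : Type*} [Field k] {n : ℕ} {p : Fin (n + 1)}
  {P : Projectivization k (Fin (n + 1) → k)}

theorem exists_rep_coordinatePoint (p : Fin (n + 1)) :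
    ∃ c : k, c ≠ 0 ∧ (coordinatePoint k p).rep = Pi.single p c := by
  obtain ⟨c, hc⟩ := Projectivization.exists_smul_eq_mk_rep k
    (Pi.single p 1 : Fin (n + 1) → k) (by simp)
  exact ⟨c, c.ne_zero, hc.symm.trans (by simp [Units.smul_def, ← Pi.single_smul])⟩

theorem eq_coordinatePoint_iff : P = coordinatePoint k p ↔ ∀ l, l ≠ p → P.rep l = 0 := by
  constructor
  · rintro rfl l hl
    obtain ⟨c, -, hc⟩ := exists_rep_coordinatePoint (k := k) p
    simp [hc, hl]
  · intro h
    rw [← P.mk_rep, coordinatePoint, Projectivization.mk_eq_mk_iff']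
    refine ⟨P.rep p, funext fun l => ?_⟩
    obtain rfl | hl := eq_or_ne l p
    · simp
    · simp [hl, h l hl]

theorem coordinatePoint_injective :
    Function.Injective (coordinatePoint k : Fin (n + 1) → _) := fun p p' h => by
  by_contra hne
  obtain ⟨c, hc, hrep⟩ := exists_rep_coordinatePoint (k := k) p
  have := eq_coordinatePoint_iff.mp h p hne
  simp [hrep, hc] at this

end CoordinatePoint

section Singular

variable {k : Type*} [Field k] [Infinite k] {n m D : ℕ} {b : Fin (n + 1) → Fin m → ℕ}
  {p : Fin (n + 1)} {q : Fin m} {P : Projectivization k (Fin (n + 1) → k)}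

theorem IsSmoothVertex.not_isSingularPoint (hsmooth : IsSmoothVertex b D q) (hD : 0 < D)
    (hsum : ∀ i, size (b i) = D) (hvert : ∀ j, Pi.single j D ∈ Set.range b)
    (hp : b p = Pi.single q D) (hP : P.rep p ≠ 0) :
    ¬ IsSingularPoint (toricVariety k b) P := by
  rw [isSingularPoint_toricVariety_iff hD hsum hvert, not_and, not_lt]
  exact fun _ => hsmooth.le_finrank hsum hp hP

theorem isSingularPoint_coordinatePoint_iff (hb : Function.Injective b) (hD : 0 < D)
    (hsum : ∀ i, size (b i) = D) (hvert : ∀ j, Pi.single j D ∈ Set.range b)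
    (hp : b p = Pi.single q D) :
    IsSingularPoint (toricVariety k b) (coordinatePoint k p) ↔ ¬ IsSmoothVertex b D q := by
  obtain ⟨c, hc, hrep⟩ := exists_rep_coordinatePoint (k := k) p
  constructor
  · intro h hsmooth
    exact hsmooth.not_isSingularPoint hD hsum hvert hp (by simp [hrep, hc]) h
  · intro h
    rw [isSingularPoint_toricVariety_iff hD hsum hvert, hrep, ← not_le]
    refine ⟨(mk_mem_toricVariety_iff hD hsum (by simp)).mpr ?_, fun hrank => h ?_⟩
    · exact single_mem_zeroLocus_toricIdeal hb hD hsum hp 1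
    · exact isSmoothVertex_of_le_finrank hb hD hsum hvert hp c hrank

theorem setOf_isSingularPoint_eq_singleton_iff (hb : Function.Injective b) (hD : 0 < D)
    (hsum : ∀ i, size (b i) = D) (hvert : ∀ j, Pi.single j D ∈ Set.range b)
    (hp : b p = Pi.single q D) :
    {P | IsSingularPoint (toricVariety k b) P} = {coordinatePoint k p} ↔
      ¬ IsSmoothVertex b D q ∧ ∀ j, j ≠ q → IsSmoothVertex b D j := by
  constructor
  · intro h
    refine ⟨(isSingularPoint_coordinatePoint_iff hb hD hsum hvert hp).mp
      (h.ge (Set.mem_singleton _)), fun j hj => ?_⟩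
    obtain ⟨i, hi⟩ := hvert j
    by_contra hsing
    have hip := coordinatePoint_injective
      (h.le ((isSingularPoint_coordinatePoint_iff (k := k) hb hD hsum hvert hi).mpr hsing))
    have := congrFun (hi.symm.trans ((congrArg b hip).trans hp)) j
    simp [hj, hD.ne'] at this
  · rintro ⟨hq, hsmooth⟩
    ext P
    rw [Set.mem_singleton_iff]
    constructor
    · intro hP
      refine eq_coordinatePoint_iff.mpr fun l hl => ?_
      refine apply_eq_zero_of_vertices_eq_zero hb hsum hvert hp (rep_mem_zeroLocus hP.1)
        (fun j hj i hi => ?_) hl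
      by_contra hne
      exact (hsmooth j hj).not_isSingularPoint hD hsum hvert hi hne hP
    · rintro rfl
      exact (isSingularPoint_coordinatePoint_iff hb hD hsum hvert hp).mpr hq

end Singular

/-! ### Sumsets -/

section Sumset

variable {d D e s : ℕ} {A : Set (Fin d → ℕ)} {y : Fin d → ℕ} {i j : Fin d}

theorem zero_mem_sumset_zero (A : Set (Fin d → ℕ)) : 0 ∈ sumset 0 A :=
  ⟨Fin.elim0, fun t => t.elim0, by simp⟩

theorem mem_sumset_one {x : Fin d → ℕ} (hx : x ∈ A) : x ∈ sumset 1 A :=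
  ⟨fun _ => x, fun _ => hx, by simp⟩

theorem add_mem_sumset {t : ℕ} {x : Fin d → ℕ} (hx : x ∈ sumset s A) (hy : y ∈ sumset t A) :
    x + y ∈ sumset (s + t) A := by
  obtain ⟨f, hf, rfl⟩ := hx
  obtain ⟨g, hg, rfl⟩ := hy
  refine ⟨Fin.append f g, fun i => ?_, by simp [Fin.sum_univ_add]⟩
  cases i using Fin.addCases with
  | left i => simpa using hf i
  | right i => simpa using hg i

theorem smul_mem_sumset {x : Fin d → ℕ} (hx : x ∈ A) (c : ℕ) : c • x ∈ sumset c A :=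
  ⟨fun _ => x, fun _ => hx, by simp⟩

theorem sum_smul_mem_sumset {ι : Type*} (I : Finset ι) (c : ι → ℕ) {x : ι → Fin d → ℕ}
    (hx : ∀ i, x i ∈ A) : ∑ i ∈ I, c i • x i ∈ sumset (∑ i ∈ I, c i) A := by
  classical
  induction I using Finset.induction_on with
  | empty => simpa using zero_mem_sumset_zero A
  | insert i I hi ih =>
    rw [Finset.sum_insert hi, Finset.sum_insert hi]
    exact add_mem_sumset (smul_mem_sumset (hx i) _) ih

theorem sumset_mono (h0 : 0 ∈ A) {t : ℕ} (h : s ≤ t) : sumset s A ⊆ sumset t A := by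
  intro x hx
  obtain ⟨r, rfl⟩ := Nat.exists_eq_add_of_le h
  simpa using add_mem_sumset hx (smul_mem_sumset h0 r)

theorem size_le_of_mem_sumset (hA : ∀ x ∈ A, size x ≤ D) (hy : y ∈ sumset s A) :
    size y ≤ s * D := by
  obtain ⟨f, hf, rfl⟩ := hy
  rw [size_sum]
  simpa using Finset.sum_le_card_nsmul Finset.univ (fun t => size (f t)) D fun t _ => hA _ (hf t)

theorem dvd_size_of_mem_sumset (hA : ∀ x ∈ A, e ∣ size x) (hy : y ∈ sumset s A) : e ∣ size y := by
  obtain ⟨f, hf, rfl⟩ := hy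
  rw [size_sum]
  exact Finset.dvd_sum fun t _ => hA _ (hf t)

theorem single_mem_sumset (hD : 0 < D) (heD : e ∣ D) (h0 : 0 ∈ A) (hAD : Pi.single i D ∈ A)
    (hAe : Pi.single i (D - e) ∈ A) {c : ℕ} (hc : e ∣ c) (hlarge : D * D ≤ c) (hs : c ≤ s * D) :
    Pi.single i c ∈ sumset s A := by
  obtain ⟨q, m, hm, hq⟩ : ∃ q m, m < D ∧ c + m = q * D := by
    have hmod := Nat.mod_lt (c + (D - 1)) hD
    have hdiv := Nat.div_add_mod' (c + (D - 1)) D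
    exact ⟨(c + (D - 1)) / D, D - 1 - (c + (D - 1)) % D, by omega, by omega⟩
  obtain ⟨r, rfl⟩ : e ∣ m := (Nat.dvd_add_right hc).mp (hq ▸ heD.mul_left q)
  have hrD : r < D :=
    (Nat.le_mul_of_pos_left r (Nat.pos_of_dvd_of_pos heD hD)).trans_lt hm
  have hDq : D ≤ q := Nat.le_of_mul_le_mul_right (by omega) hD
  have hqs : q ≤ s := by
    refine Nat.lt_succ_iff.mp (Nat.lt_of_mul_lt_mul_right (a := D) ?_)
    rw [Nat.succ_mul]
    omega
  obtain ⟨p, rfl⟩ := Nat.exists_eq_add_of_le' (hrD.le.trans hDq)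
  obtain ⟨D', rfl⟩ := Nat.exists_eq_add_of_le' (Nat.le_of_dvd hD heD)
  rw [Nat.add_sub_cancel] at hAe
  have hc' : c = p * (D' + e) + r * D' := by linarith
  rw [hc', Pi.single_add, ← smul_eq_mul, ← smul_eq_mul, Pi.single_smul', Pi.single_smul']
  exact sumset_mono h0 hqs (add_mem_sumset (smul_mem_sumset hAD p) (smul_mem_sumset hAe r))

/- Split off `(y j / D) • D εⱼ` and `(y j % D) • ((D - 1) εᵢ + εⱼ)` for `j ≠ i`; what is left is a
multiple of `εᵢ`. All the vectors split off have size `D`, so no summand is wasted. -/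
theorem mem_sumset_of_le_apply (hD : 0 < D) (heD : e ∣ D) (h0 : 0 ∈ A)
    (hA : ∀ i j : Fin d, Pi.single i (D - 1) + Pi.single j 1 ∈ A)
    (hAe : ∀ i : Fin d, Pi.single i (D - e) ∈ A) (hy : e ∣ size y)
    (hi : D * D + D * ∑ j ∈ Finset.univ.erase i, y j % D ≤ y i) (hs : size y ≤ s * D) :
    y ∈ sumset s A := by
  have hAD : ∀ j, Pi.single j D ∈ A := fun j => by
    simpa only [← Pi.single_add, Nat.sub_add_cancel hD] using hA j j
  obtain ⟨D, rfl⟩ := Nat.exists_eq_add_of_le' hD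
  rw [Nat.add_sub_cancel] at hA
  set Q := ∑ j ∈ Finset.univ.erase i, y j / (D + 1) with hQ
  set R := ∑ j ∈ Finset.univ.erase i, y j % (D + 1) with hR
  obtain ⟨c, hc⟩ := Nat.exists_eq_add_of_le' (show D * R ≤ y i by nlinarith)
  have hsize : size y = c + (Q + R) * (D + 1) := by
    have hrest : ∑ j ∈ Finset.univ.erase i, y j = Q * (D + 1) + R := by
      rw [hQ, hR, Finset.sum_mul, ← Finset.sum_add_distrib]
      exact Finset.sum_congr rfl fun j _ => (Nat.div_add_mod' _ _).symm
    rw [← apply_add_sum_erase y i, hrest, hc]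
    ring
  obtain ⟨t, rfl⟩ := Nat.exists_eq_add_of_le
    (Nat.le_of_mul_le_mul_right (show (Q + R) * (D + 1) ≤ s * (D + 1) by linarith) hD)
  have haxis : Pi.single i c ∈ sumset t A := by
    refine single_mem_sumset hD heD h0 (hAD i) (hAe i) ?_ (by nlinarith) (by nlinarith)
    exact (Nat.dvd_add_left (heD.mul_left (Q + R))).mp (hsize ▸ hy)
  convert! add_mem_sumset (add_mem_sumset
    (sum_smul_mem_sumset (Finset.univ.erase i) (fun j => y j / (D + 1)) hAD)
    (sum_smul_mem_sumset (Finset.univ.erase i) (fun j => y j % (D + 1)) (hA i))) haxis using 1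
  refine eq_of_size_eq_of_forall_ne ?_ i fun l hl => ?_
  · simp only [size_add, size_sum, size_smul, size_single, ← Finset.sum_mul, ← hQ, ← hR, hsize]
    ring
  · simp [Finset.sum_apply, Pi.single_apply, hl, Nat.div_add_mod']

theorem exists_finite_forall_mem_sumset (hD : 0 < D) (heD : e ∣ D) (h0 : 0 ∈ A)
    (hA : ∀ i j : Fin d, Pi.single i (D - 1) + Pi.single j 1 ∈ A)
    (hAe : ∀ i : Fin d, Pi.single i (D - e) ∈ A) :
    ∃ B : Set (Fin d → ℕ), B.Finite ∧
      ∀ y, e ∣ size y → y ∉ B → ∀ s, size y ≤ s * D → y ∈ sumset s A := by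
  refine ⟨Set.Iic fun _ => D * D + D * (d * D), Set.finite_Iic _, fun y hy hyB s hs => ?_⟩
  obtain ⟨i, hi⟩ : ∃ i, D * D + D * (d * D) < y i := by simpa [Pi.le_def] using hyB
  refine mem_sumset_of_le_apply hD heD h0 hA hAe hy (le_trans ?_ hi.le) hs
  gcongr
  calc ∑ j ∈ Finset.univ.erase i, y j % D
      ≤ ∑ j, y j % D := Finset.sum_le_univ_sum_of_nonneg fun _ => Nat.zero_le _
    _ ≤ d * D := by
      simpa using Finset.sum_le_card_nsmul Finset.univ (y · % D) D fun j _ => (Nat.mod_lt _ hD).le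

theorem exists_sumset_eq_simplexMod_diff (h0 : 0 ∈ A) (hsize : ∀ x ∈ A, size x ≤ D)
    (hdvd : ∀ x ∈ A, e ∣ size x) {B : Set (Fin d → ℕ)} (hB : B.Finite)
    (hAB : ∀ y, e ∣ size y → y ∉ B → ∀ s, size y ≤ s * D → y ∈ sumset s A) :
    ∃ s₀, ∀ s, s₀ ≤ s →
      sumset s A = simplexMod d D s e \ (latticeMod d e \ ⋃ t, sumset t A) := by
  have hstable : ∀ᶠ s in Filter.atTop, ∀ y ∈ B, y ∈ ⋃ t, sumset t A → y ∈ sumset s A := by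
    refine (Filter.eventually_all_finite hB).mpr fun y _ => ?_
    by_cases hy : y ∈ ⋃ t, sumset t A
    · obtain ⟨t, ht⟩ := Set.mem_iUnion.mp hy
      filter_upwards [Filter.eventually_ge_atTop t] with s hs _ using sumset_mono h0 hs ht
    · exact Filter.Eventually.of_forall fun s h => absurd h hy
  obtain ⟨s₀, hs₀⟩ := Filter.eventually_atTop.mp hstable
  refine ⟨s₀, fun s hs => Set.Subset.antisymm (fun y hy => ?_) ?_⟩
  · exact ⟨⟨dvd_size_of_mem_sumset hdvd hy, size_le_of_mem_sumset hsize hy⟩,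
      fun h => h.2 (Set.mem_iUnion_of_mem s hy)⟩
  · rintro y ⟨⟨hye, hys⟩, hygap⟩
    by_cases hyB : y ∈ B
    · exact hs₀ s hs y hyB (by_contra fun h => hygap ⟨hye, h⟩)
    · exact hAB y hye hyB s hys

theorem single_one_mem_of_mem_sumset (h : Pi.single j 1 ∈ sumset s A) : Pi.single j 1 ∈ A := by
  obtain ⟨f, hf, hsum⟩ := h
  obtain ⟨t, -, ht⟩ : ∃ t ∈ Finset.univ, f t j ≠ 0 := by
    refine Finset.exists_ne_zero_of_sum_ne_zero ?_
    rw [← Finset.sum_apply, ← hsum, Pi.single_eq_same]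
    exact one_ne_zero
  have hle : f t ≤ Pi.single j 1 :=
    hsum ▸ Finset.single_le_sum (f := f) (fun _ _ => zero_le) (Finset.mem_univ t)
  have hft : f t = Pi.single j 1 :=
    le_antisymm hle fun l => by
      rcases eq_or_ne l j with rfl | hl
      · simpa [Nat.one_le_iff_ne_zero] using ht
      · simp [hl]
  exact hft ▸ hf t

theorem size_sum_le_size_add {f : Fin (s + 1) → Fin d → ℕ} (hf : ∀ t, size (f t) ≤ D)
    (t : Fin (s + 1)) : size (∑ t, f t) ≤ size (f t) + s * D := by
  rw [Fin.sum_univ_succAbove f t, size_add]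
  gcongr
  exact size_le_of_mem_sumset (A := {x | size x ≤ D}) (fun _ h => h) ⟨_, fun l => hf _, rfl⟩

theorem single_add_single_mem_of_add_smul_mem_sumset (hD : 0 < D) (hsize : ∀ x ∈ A, size x ≤ D)
    (hij : j ≠ i)
    (h : Pi.single i (D - 1) + Pi.single j 1 + s • Pi.single i D ∈ sumset (s + 1) A) :
    Pi.single i (D - 1) + Pi.single j 1 ∈ A := by
  obtain ⟨f, hf, hsum⟩ := h
  have hsum_apply (l : Fin d) := congrFun hsum l
  obtain ⟨t, -, ht⟩ : ∃ t ∈ Finset.univ, f t j ≠ 0 := by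
    refine Finset.exists_ne_zero_of_sum_ne_zero ?_
    rw [← Finset.sum_apply, ← hsum_apply]
    simp
  have hle (l : Fin d) : f t l ≤ (∑ t, f t) l :=
    Finset.single_le_sum (f := f) (fun _ _ => zero_le) (Finset.mem_univ t) l
  have hft := eq_single_add_single_of_forall_ne_eq_zero (x := f t) hij fun l hli hlj => by
    simpa only [← hsum_apply, Pi.add_apply, Pi.smul_apply, Pi.single_eq_of_ne hli,
      Pi.single_eq_of_ne hlj, smul_zero, add_zero, Nat.le_zero] using hle l
  have htj : f t j = 1 := by
    have hle_one : f t j ≤ 1 := by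
      simpa only [← hsum_apply, Pi.add_apply, Pi.smul_apply, Pi.single_eq_of_ne hij,
        Pi.single_eq_same, smul_zero, add_zero, zero_add] using hle j
    omega
  have hsize_ft : size (f t) = D := by
    have hge := size_sum_le_size_add (fun t => hsize _ (hf t)) t
    rw [← hsum, size_add, size_add, size_smul, size_single, size_single, size_single] at hge
    have := hsize _ (hf t)
    omega
  rw [htj, hsize_ft] at hft
  exact hft ▸ hf t

theorem single_sub_mem_of_add_smul_mem_sumset (hD : 0 < D) (he : 0 < e) (heD : e ∣ D)
    (hsize : ∀ x ∈ A, size x ≤ D) (hdvd : ∀ x ∈ A, e ∣ size x)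
    (h : Pi.single i (D - e) + s • Pi.single i D ∈ sumset (s + 1) A) :
    Pi.single i (D - e) ∈ A := by
  obtain ⟨f, hf, hsum⟩ := h
  have hsize_sum : size (∑ t, f t) = D - e + s * D := by
    rw [← hsum, size_add, size_smul, size_single, size_single]
  have heD' := Nat.le_of_dvd hD heD
  obtain ⟨t, -, ht⟩ : ∃ t ∈ Finset.univ, size (f t) < D := by
    refine Finset.exists_lt_of_sum_lt ?_
    rw [← size_sum, hsize_sum, Finset.sum_const, Finset.card_univ, Fintype.card_fin, smul_eq_mul,
      Nat.succ_mul]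
    omega
  have hft := eq_single_of_forall_ne_eq_zero (x := f t) (q := i) fun l hl => by
    have hle := Finset.single_le_sum (f := f) (fun _ _ => zero_le) (Finset.mem_univ t) l
    simpa only [← hsum, Pi.add_apply, Pi.smul_apply, Pi.single_eq_of_ne hl, smul_zero, add_zero,
      Nat.le_zero] using hle
  have hsize_ft : size (f t) = D - e := by
    have hge := size_sum_le_size_add (fun t => hsize _ (hf t)) t
    have hle := Nat.le_of_dvd (by omega) (Nat.dvd_sub heD (hdvd _ (hf t)))
    omega
  rw [hsize_ft] at hft
  exact hft ▸ hf t

end Sumset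

section Shape

variable {d n D e : ℕ} {a : Fin (n + 1) → Fin d → ℕ}

theorem AffineShape.sumsetStructure (h : AffineShape D a e) (hD : 0 < D)
    (hsize : ∀ i, size (a i) ≤ D) : SumsetStructure D a e := by
  obtain ⟨he, -, heD, h0, hA, hAe, hdvd, hone⟩ := h
  obtain ⟨B, hB, hAB⟩ := exists_finite_forall_mem_sumset hD heD h0 hA hAe
  obtain ⟨s₀, hs₀⟩ := exists_sumset_eq_simplexMod_diff h0 (Set.forall_mem_range.mpr hsize)
    (Set.forall_mem_range.mpr hdvd) hB hAB
  refine ⟨he, _, hB.subset fun y hy => ?_, Set.sdiff_subset, fun he1 => ?_, s₀, hs₀⟩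
  · by_contra hyB
    exact hy.2 (Set.mem_iUnion_of_mem _ (hAB y hy.1 hyB _ (Nat.le_mul_of_pos_right _ hD)))
  · obtain ⟨j, hj⟩ := hone he1
    refine ⟨Pi.single j 1, by simp [latticeMod, he1], fun hmem => ?_⟩
    obtain ⟨s, hs⟩ := Set.mem_iUnion.mp hmem
    exact hj (single_one_mem_of_mem_sumset hs)

theorem exists_add_smul_mem_sumset {A H : Set (Fin d → ℕ)} (hD : 0 < D) (hH : H.Finite) {s₀ : ℕ}
    (hs : ∀ s, s₀ ≤ s → sumset s A = simplexMod d D s e \ H) (heD : e ∣ D) {z : Fin d → ℕ}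
    (hze : e ∣ size z) (hzD : size z ≤ D) (i : Fin d) :
    ∃ s, z + s • Pi.single i D ∈ sumset (s + 1) A := by
  have hinj : Function.Injective fun s : ℕ => z + s • (Pi.single i D : Fin d → ℕ) := by
    intro s t hst
    have hi : s * D = t * D := by simpa using congrFun hst i
    exact Nat.eq_of_mul_eq_mul_right hD hi
  obtain ⟨s, hsH, hss₀⟩ :=
    ((hH.preimage hinj.injOn).infinite_compl.sdiff (Set.finite_Iio s₀)).nonempty
  refine ⟨s, ?_⟩
  rw [hs (s + 1) (by rw [Set.mem_Iio] at hss₀; omega)]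
  refine ⟨⟨?_, ?_⟩, hsH⟩
  · change e ∣ size _
    rw [size_add, size_smul, size_single]
    exact dvd_add hze (heD.mul_left s)
  · rw [size_add, size_smul, size_single]
    linarith

theorem SumsetStructure.dvd_size (h : SumsetStructure D a e)
    {j : Fin d} (haD : Pi.single j D ∈ Set.range a) (i : Fin (n + 1)) : e ∣ size (a i) := by
  obtain ⟨-, H, -, -, -, s₀, hs⟩ := h
  have hdvd : ∀ s, s₀ ≤ s → ∀ y ∈ sumset s (Set.range a), e ∣ size y := fun s h y hy =>
    ((hs s h).le hy).1.1
  have hs₀ := hdvd s₀ le_rfl _ (smul_mem_sumset haD s₀)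
  have hs₀' := hdvd (s₀ + 1) (Nat.le_succ s₀) _
    (add_mem_sumset (smul_mem_sumset haD s₀) (mem_sumset_one ⟨i, rfl⟩))
  rw [size_add] at hs₀'
  exact (Nat.dvd_add_right hs₀).mp hs₀'

theorem SumsetStructure.exists_single_one_notMem (h : SumsetStructure D a 1)
    (h0 : 0 ∈ Set.range a) : ∃ j, Pi.single j 1 ∉ Set.range a := by
  obtain ⟨-, H, -, -, hne, s₀, hs⟩ := h
  by_contra! hone
  obtain ⟨y, hy⟩ := hne rfl
  have hmem : y ∈ sumset (size y) (Set.range a) := by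
    have hsum : ∑ j, y j • (Pi.single j 1 : Fin d → ℕ) = y := by
      simp only [← Pi.single_smul', smul_eq_mul, mul_one]
      exact Finset.univ_sum_single y
    rw [← hsum]
    simpa only [size_sum, size_smul, size_single, mul_one] using
      sum_smul_mem_sumset Finset.univ y hone
  exact ((hs _ (le_max_right _ _)).le (sumset_mono h0 (le_max_left _ s₀) hmem)).2 hy

theorem SumsetStructure.affineShape (h : SumsetStructure D a e) (hd : 0 < d) (hD : 0 < D)
    (h0 : 0 ∈ Set.range a) (haD : ∀ j, Pi.single j D ∈ Set.range a)
    (hsize : ∀ i, size (a i) ≤ D) : AffineShape D a e := by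
  have hdvd := h.dvd_size (haD ⟨0, hd⟩)
  have heD : e ∣ D := by
    obtain ⟨i, hi⟩ := haD ⟨0, hd⟩
    simpa only [hi, size_single] using hdvd i
  have hsize' : ∀ x ∈ Set.range a, size x ≤ D := Set.forall_mem_range.mpr hsize
  obtain ⟨he, H, hH, -, -, s₀, hs⟩ := id h
  refine ⟨he, Nat.le_of_dvd hD heD, heD, h0, fun i j => ?_, fun i => ?_, hdvd, ?_⟩
  · rcases eq_or_ne j i with rfl | hij
    · rw [← Pi.single_add, Nat.sub_add_cancel hD]
      exact haD j
    · have hz : size (Pi.single i (D - 1) + Pi.single j 1 : Fin d → ℕ) = D := by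
        rw [size_add, size_single, size_single, Nat.sub_add_cancel hD]
      obtain ⟨s, hmem⟩ := exists_add_smul_mem_sumset hD hH hs heD (hz.symm ▸ heD) hz.le i
      exact single_add_single_mem_of_add_smul_mem_sumset hD hsize' hij hmem
  · have hz : size (Pi.single i (D - e) : Fin d → ℕ) = D - e := size_single i _
    obtain ⟨s, hmem⟩ := exists_add_smul_mem_sumset hD hH hs heD
      (hz.symm ▸ Nat.dvd_sub heD dvd_rfl) (hz.trans_le (Nat.sub_le D e)) i
    exact single_sub_mem_of_add_smul_mem_sumset hD he heD hsize'
      (Set.forall_mem_range.mpr hdvd) hmem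
  · rintro rfl
    exact h.exists_single_one_notMem h0

theorem affineShape_iff_sumsetStructure (hd : 0 < d) (hD : 0 < D) (h0 : 0 ∈ Set.range a)
    (haD : ∀ j, Pi.single j D ∈ Set.range a) (hsize : ∀ i, size (a i) ≤ D) :
    AffineShape D a e ↔ SumsetStructure D a e :=
  ⟨fun h => h.sumsetStructure hD hsize, fun h => h.affineShape hd hD h0 haD hsize⟩

end Shape

/-! ### Homogenization -/

section EdgeGenerator

variable {ι : Type*} {m D g g' : ℕ} {b : ι → Fin m → ℕ} {q q' j : Fin m}

theorem IsEdgeGenerator.eq (h : IsEdgeGenerator b D q j g) (h' : IsEdgeGenerator b D q' j g')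
    (hq : q ≠ j) (hq' : q' ≠ j) : g = g' := by
  have dvd_of_isEdgeGenerator {q q' : Fin m} {g g' : ℕ} (hq' : q' ≠ j)
      (h : IsEdgeGenerator b D q j g) (h' : IsEdgeGenerator b D q' j g') : g ∣ g' := by
    obtain ⟨l, hl⟩ := h'.2.2.1
    simpa [hl, hq'.symm] using h.2.2.2 l
  exact Nat.dvd_antisymm (dvd_of_isEdgeGenerator hq' h h') (dvd_of_isEdgeGenerator hq h' h)

theorem IsEdgeGenerator.dvd_apply (h : IsEdgeGenerator b D q j g) (hj : IsSmoothVertex b D j)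
    (hvert : Pi.single j D ∈ Set.range b) (l : ι) (t : Fin m) : g ∣ b l t := by
  rcases eq_or_ne t j with rfl | htj
  · exact h.2.2.2 l
  obtain ⟨g', -, hg'D, ⟨l', hl'⟩, hg'⟩ := hj t htj
  have hgD : g ∣ D := by
    obtain ⟨p, hp⟩ := hvert
    simpa [hp] using h.2.2.2 p
  have hgD' : g ∣ D - g' := by simpa [hl', htj.symm] using h.2.2.2 l'
  exact ((Nat.dvd_sub_iff_right hg'D hgD).mp hgD').trans (hg' l)

end EdgeGenerator

section Homogenization

variable {d n D e : ℕ} {a : Fin (n + 1) → Fin d → ℕ}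

theorem homogenization_apply_zero (i : Fin (n + 1)) :
    homogenization D a i 0 = D - size (a i) := rfl

theorem size_homogenization {i : Fin (n + 1)} (hsize : size (a i) ≤ D) :
    size (homogenization D a i) = D := by
  rw [size, Fin.sum_univ_succ]
  exact Nat.sub_add_cancel hsize

theorem homogenization_injective (ha : Function.Injective a) :
    Function.Injective (homogenization D a) := fun _ _ h =>
  ha (funext fun j => congrFun h j.succ)

theorem homogenization_zero (ha0 : a 0 = 0) : homogenization D a 0 = Pi.single 0 D := by
  ext j
  cases j using Fin.cases with
  | zero => simp [homogenization_apply_zero, ha0, size_zero]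
  | succ j => simp [homogenization, ha0]

theorem mem_range_homogenization_iff {w : Fin (d + 1) → ℕ} (hw : size w = D) :
    w ∈ Set.range (homogenization D a) ↔ Fin.tail w ∈ Set.range a := by
  constructor
  · rintro ⟨i, rfl⟩
    exact ⟨i, rfl⟩
  · rintro ⟨i, hi⟩
    refine ⟨i, ?_⟩
    rw [homogenization, hi, ← hw, size, Fin.sum_univ_succ]
    exact (congrArg (Fin.cons · (Fin.tail w)) (Nat.add_sub_cancel _ _)).trans (Fin.cons_self_tail w)

theorem tail_single_zero (c : ℕ) : Fin.tail (Pi.single 0 c : Fin (d + 1) → ℕ) = 0 := by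
  ext j
  simp [Fin.tail]

theorem tail_single_succ (i : Fin d) (c : ℕ) :
    Fin.tail (Pi.single i.succ c : Fin (d + 1) → ℕ) = Pi.single i c := by
  ext j
  simp [Fin.tail, Pi.single_apply]

theorem tail_add (x y : Fin (d + 1) → ℕ) : Fin.tail (x + y) = Fin.tail x + Fin.tail y := rfl

theorem single_mem_range_homogenization (h0 : 0 ∈ Set.range a)
    (haD : ∀ j : Fin d, Pi.single j D ∈ Set.range a) (j : Fin (d + 1)) :
    Pi.single j D ∈ Set.range (homogenization D a) := by
  rw [mem_range_homogenization_iff (size_single j D)]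
  cases j using Fin.cases with
  | zero => rwa [tail_single_zero]
  | succ j => simpa only [tail_single_succ] using haD j

theorem single_add_single_mem_range_homogenization_iff {p q : Fin (d + 1)} {c : ℕ} (hc : c ≤ D) :
    Pi.single p (D - c) + Pi.single q c ∈ Set.range (homogenization D a) ↔
      Fin.tail (Pi.single p (D - c) + Pi.single q c : Fin (d + 1) → ℕ) ∈ Set.range a := by
  refine mem_range_homogenization_iff ?_
  rw [size_add, size_single, size_single, Nat.sub_add_cancel hc]

theorem homogenizedShape_iff_affineShape (hD : 0 < D) (h0 : 0 ∈ Set.range a)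
    (hsize : ∀ i, size (a i) ≤ D) : HomogenizedShape D a e ↔ AffineShape D a e := by
  refine and_congr_right fun _ => and_congr_right fun heD => and_congr_right fun hdvd => ?_
  have hdvd_zero (i) : e ∣ homogenization D a i 0 ↔ e ∣ size (a i) :=
    Nat.dvd_sub_iff_right (hsize i) hdvd
  simp only [add_comm (Pi.single 0 e : Fin (d + 1) → ℕ),
    single_add_single_mem_range_homogenization_iff heD,
    single_add_single_mem_range_homogenization_iff hD, tail_add, tail_single_zero, tail_single_succ,
    zero_add, add_zero, hdvd_zero, h0, true_and]

end Homogenization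

section SmoothVertex

variable {d n D e : ℕ} {a : Fin (n + 1) → Fin d → ℕ}

theorem IsEdgeGenerator.eq_one {q : Fin (d + 1)} {j : Fin d} {g : ℕ}
    (h : IsEdgeGenerator (homogenization D a) D q j.succ g)
    (hj : IsSmoothVertex (homogenization D a) D j.succ)
    (hvert : Pi.single j.succ D ∈ Set.range (homogenization D a))
    (hgcd : ∀ g : ℕ, (∀ i j, g ∣ a i j) → g = 1) : g = 1 :=
  hgcd g fun l t => h.dvd_apply hj hvert l t.succ

theorem HomogenizedShape.isSmoothVertex_succ (h : HomogenizedShape D a e) (i : Fin d) :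
    IsSmoothVertex (homogenization D a) D i.succ := by
  obtain ⟨he, heD, -, hA, hAe, hdvd, -⟩ := h
  intro j hj
  cases j using Fin.cases with
  | zero => exact ⟨e, Nat.ne_of_gt he, heD, by simpa only [add_comm] using hAe i, hdvd⟩
  | succ j => exact ⟨1, one_ne_zero, he.trans heD, hA i j, fun _ => one_dvd _⟩

theorem HomogenizedShape.not_isSmoothVertex_zero (h : HomogenizedShape D a e) (hd : 0 < d)
    (hvert : ∀ j, Pi.single j D ∈ Set.range (homogenization D a))
    (hgcd : ∀ g : ℕ, (∀ i j, g ∣ a i j) → g = 1) :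
    ¬ IsSmoothVertex (homogenization D a) D 0 := by
  intro hzero
  have hmem (j : Fin d) :
      Pi.single 0 (D - 1) + Pi.single j.succ 1 ∈ Set.range (homogenization D a) := by
    obtain ⟨g, hg⟩ := hzero j.succ (Fin.succ_ne_zero j)
    obtain rfl := hg.eq_one (h.isSmoothVertex_succ j) (hvert _) hgcd
    exact hg.2.2.1
  obtain ⟨he, heD, hdvdD, -, -, hdvd, hone⟩ := h
  have he1 : e = 1 := by
    obtain ⟨l, hl⟩ := hmem ⟨0, hd⟩
    have hdvd_sub : e ∣ D - 1 := by simpa [hl] using hdvd l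
    exact Nat.dvd_one.mp ((Nat.dvd_sub_iff_right (he.trans heD) hdvdD).mp hdvd_sub)
  obtain ⟨j, hj⟩ := hone he1
  exact hj (hmem j)

theorem exists_homogenizedShape (hd : 0 < d) (hD : 0 < D)
    (hvert : ∀ j, Pi.single j D ∈ Set.range (homogenization D a))
    (hgcd : ∀ g : ℕ, (∀ i j, g ∣ a i j) → g = 1)
    (hzero : ¬ IsSmoothVertex (homogenization D a) D 0)
    (hsucc : ∀ i : Fin d, IsSmoothVertex (homogenization D a) D i.succ) :
    ∃ e, HomogenizedShape D a e := by
  have zero_ne_succ (i : Fin d) : 0 ≠ i.succ := (Fin.succ_ne_zero i).symm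
  obtain ⟨e, he⟩ := hsucc ⟨0, hd⟩ 0 (zero_ne_succ _)
  have hgen_zero (i : Fin d) : IsEdgeGenerator (homogenization D a) D i.succ 0 e := by
    obtain ⟨g, hg⟩ := hsucc i 0 (zero_ne_succ i)
    obtain rfl := he.eq hg (Fin.succ_ne_zero _) (Fin.succ_ne_zero _)
    exact hg
  have hdvd : e ∣ D := by
    obtain ⟨p, hp⟩ := hvert 0
    simpa [hp] using he.2.2.2 p
  refine ⟨e, Nat.pos_of_ne_zero he.1, he.2.1, hdvd, fun i j => ?_,
    fun j => by simpa only [add_comm] using (hgen_zero j).2.2.1, he.2.2.2, fun _ => ?_⟩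
  · rcases eq_or_ne i j with rfl | hij
    · rw [← Pi.single_add, Nat.sub_add_cancel hD]
      exact hvert i.succ
    · obtain ⟨g, hg⟩ := hsucc i j.succ ((Fin.succ_injective d).ne hij.symm)
      obtain rfl := hg.eq_one (hsucc j) (hvert _) hgcd
      exact hg.2.2.1
  · by_contra! hall
    refine hzero fun j hj => ?_
    obtain ⟨i, rfl⟩ := Fin.exists_succ_eq.mpr hj
    exact ⟨1, one_ne_zero, hD, hall i, fun _ => one_dvd _⟩

theorem singleSingularPoint_iff_exists_homogenizedShape {k : Type*} [Field k] [Infinite k]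
    (hd : 0 < d) (hD : 0 < D) (ha : Function.Injective a) (ha0 : a 0 = 0)
    (haD : ∀ j : Fin d, Pi.single j D ∈ Set.range a) (hsize : ∀ i, size (a i) ≤ D)
    (hgcd : ∀ g : ℕ, (∀ i j, g ∣ a i j) → g = 1) :
    SingleSingularPoint k D a ↔ ∃ e, HomogenizedShape D a e := by
  have hvert := single_mem_range_homogenization ⟨0, ha0⟩ haD
  refine (setOf_isSingularPoint_eq_singleton_iff (homogenization_injective ha) hD
    (fun i => size_homogenization (hsize i)) hvert (homogenization_zero ha0)).trans ?_
  rw [Fin.forall_fin_succ]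
  constructor
  · rintro ⟨hzero, -, hsucc⟩
    exact exists_homogenizedShape hd hD hvert hgcd hzero fun i => hsucc i (Fin.succ_ne_zero i)
  · rintro ⟨e, h⟩
    exact ⟨h.not_isSmoothVertex_zero hd hvert hgcd, fun h0 => absurd rfl h0,
      fun i _ => h.isSmoothVertex_succ i⟩

end SmoothVertex

end OneSing

end

theorem mainTheorem11_general {k : Type*} [Field k] [Infinite k] {n d D : ℕ} (hd : 0 < d)
    (hD : 0 < D) {a : Fin (n + 1) → Fin d → ℕ} (ha : Function.Injective a) (ha0 : a 0 = 0)
    (haD : ∀ j : Fin d, Pi.single j D ∈ Set.range a) (hsize : ∀ i, OneSing.size (a i) ≤ D) :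
    ((∀ g : ℕ, (∀ i j, g ∣ a i j) → g = 1) →
      [OneSing.SingleSingularPoint k D a,
        ∃ e, OneSing.HomogenizedShape D a e,
        ∃ e, OneSing.AffineShape D a e,
        ∃ e, OneSing.SumsetStructure D a e].TFAE) ∧
    ∀ e, [OneSing.HomogenizedShape D a e, OneSing.AffineShape D a e,
      OneSing.SumsetStructure D a e].TFAE := by
  have hbc (e) := OneSing.homogenizedShape_iff_affineShape (e := e) hD ⟨0, ha0⟩ hsize
  have hcd (e) := OneSing.affineShape_iff_sumsetStructure (e := e) hd hD ⟨0, ha0⟩ haD hsize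
  refine ⟨fun hgcd => ?_, fun e => ?_⟩
  · tfae_have 1 ↔ 2 :=
      OneSing.singleSingularPoint_iff_exists_homogenizedShape hd hD ha ha0 haD hsize hgcd
    tfae_have 2 ↔ 3 := exists_congr hbc
    tfae_have 3 ↔ 4 := exists_congr hcd
    tfae_finish
  · tfae_have 1 ↔ 2 := hbc e
    tfae_have 2 ↔ 3 := hcd e
    tfae_finish

theorem mainTheorem11 {k : Type*} [Field k] [IsAlgClosed k] (n d D : ℕ) (hd : 1 ≤ d) (hnd : d ≤ n)
    (hD : 2 ≤ D) (a : Fin (n + 1) → Fin d → ℕ) (ha : Function.Injective a)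
    (ha0 : a 0 = 0) (haD : ∀ j : Fin d, (Pi.single j D : Fin d → ℕ) ∈ Set.range a)
    (hsize : ∀ i, OneSing.size (a i) ≤ D) :
    ((∀ g : ℕ, (∀ i j, g ∣ a i j) → g = 1) →
      [OneSing.SingleSingularPoint k D a,
        ∃ e, OneSing.HomogenizedShape D a e,
        ∃ e, OneSing.AffineShape D a e,
        ∃ e, OneSing.SumsetStructure D a e].TFAE) ∧
    ∀ e, [OneSing.HomogenizedShape D a e, OneSing.AffineShape D a e, OneSing.SumsetStructure D a e].TFAE :=
  mainTheorem11_general hd (by omega) ha ha0 haD hsize
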